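/- **Conventions.** An abelian heap is a (possibly empty) set $H$ with a ternary operation satisfying $[[a,b,c],d,e]=[a,b,[c,d,e]]$, $[a,b,b]=a=[b,b,a]$ and $[a,b,c]=[c,b,a]$; for $e\in H$, the retract $\mathrm G(H;e)$ is the abelian group $H$ with $a+b=[a,e,b]$ and neutral element $e$. A truss $T$ is an abelian heap with an associative multiplication distributing over $[-,-,-]$ on both sides; a (left) $T$-module is an abelian heap $M$ with an associative action of $T$ satisfying $[t,t',t'']\cdot m=[t\cdot m,t'\cdot m,t''\cdot m]$ and $t\cdot[m,m',m'']=[t\cdot m,t\cdot m',t\cdot m'']$. Homomorphisms ($T$-linear maps) preserve all operations, and the sets $\mathrm{Hom}_T(M,N)$ are abelian heaps pointwise. Neither rings, trusses nor modules are assumed unital unless stated. A $T$-module $P$ is *projective* if $T$-linear maps from $P$ lift along surjective $T$-linear maps; *finitely generated* if it has a finite subset contained in no proper submodule (a submodule being a subset closed under the heap operation and the action); *tiny* if it is finitely generated and the functor $\mathrm{Hom}_T(P,-)$ from $T$-modules to abelian heaps preserves finite colimits. For a ring $R$, $\mathrm T(R)$ is the truss $R$ with $[a,b,c]=a-b+c$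 and the multiplication of $R$; for an $R$-module $P$, $\mathrm T(P)$ is the $\mathrm T(R)$-module $P$ with $[a,b,c]=a-b+c$ and the same action. For a $\mathrm T(R)$-module $P$, let $\mathrm{Abs}(P)=\{p\in P: r\cdot p=p \text{ for all } r\in R\}$, and let $P_{\mathrm{Abs}}$ be the $R$-module $\mathrm G(P/\mathrm{Abs}(P);\mathrm{Abs}(P))$, where $P/\mathrm{Abs}(P)$ is the quotient heap by $a\sim b\iff [a,b,s]\in\mathrm{Abs}(P)$ for some $s\in\mathrm{Abs}(P)$, with the induced action; $\varnothing_{\mathrm{Abs}}=0$. **Proposition.** Let $R$ be a ring. 1. If $P$ is a projective $\mathrm T(R)$-module, then $P_{\mathrm{Abs}}$ is a projective $R$-module. 2. If $P$ is a finitely generated $\mathrm T(R)$-module, then $P_{\mathrm{Abs}}$ is a finitely generated $R$-module. 3. If $P$ is a tiny $\mathrm T(R)$-module, then $P_{\mathrm{Abs}}$ is a finitely generated and projective $R$-module. 4. An $R$-module $P$ is finitely generated and projective if and only if $\mathrm T(P)$ is a tiny $\mathrm T(R)$-module. Here $R$-modules, projectivity and finite generation are understood in the category of all (not necessarily unital)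 $R$-modules. If $R$ has an identity, then 1–3 also hold for unital $\mathrm T(R)$-modules $P$ and 4 for unital $R$-modules $P$, with $P_{\mathrm{Abs}}$ a unital $R$-module and "finitely generated" and "projective" over $R$ having their usual meaning for unital $R$-modules. -/

import Mathlib

open CategoryTheory

set_option linter.style.haveILetI false

universe u

namespace TrussMod

/-! Abelian heaps, trusses and modules over trusses -/

/-- An abelian heap: a (possibly empty) type with an associative ternary operation `br a b c`,
usually written `[a, b, c]`, that satisfies the Mal'cev identities and `[a, b, c] = [c, b, a]`. -/
class AbHeap (H : Type u) where
  br : H → H → H → H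
  br_assoc : ∀ a b c d e, br (br a b c) d e = br a b (br c d e)
  br_right : ∀ a b, br a b b = a
  br_left : ∀ a b, br b b a = a
  br_comm : ∀ a b c, br a b c = br c b a

open AbHeap

/-- A truss, not necessarily unital. -/
class Truss (T : Type u) extends AbHeap T, Semigroup T where
  mul_br : ∀ s a b c : T, s * br a b c = br (s * a) (s * b) (s * c)
  br_mul : ∀ a b c s : T, br a b c * s = br (a * s) (b * s) (c * s)

/-- A left module over a truss: an abelian heap with an associative action that distributes over
the heap operations. Neither non-emptiness nor unitality is required. -/
class TrussModule (T M : Type u) [Truss T] [AbHeap M] extends SMul T M where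
  smul_smul' : ∀ (s t : T) (m : M), s • (t • m) = (s * t) • m
  br_smul : ∀ (a b c : T) (m : M), (br a b c) • m = br (a • m) (b • m) (c • m)
  smul_br : ∀ (t : T) (a b c : M), t • br a b c = br (t • a) (t • b) (t • c)

/-- Homomorphisms of abelian heaps. -/
@[ext] structure HeapHom (H K : Type u) [AbHeap H] [AbHeap K] where
  toFun : H → K
  map_br : ∀ a b c, toFun (br a b c) = br (toFun a) (toFun b) (toFun c)

/-- Homomorphisms of modules over a truss. -/
@[ext] structure ModHom (T M N : Type u) [Truss T] [AbHeap M] [TrussModule T M]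
    [AbHeap N] [TrussModule T N] where
  toFun : M → N
  map_br : ∀ a b c, toFun (br a b c) = br (toFun a) (toFun b) (toFun c)
  map_smul : ∀ (t : T) (m : M), toFun (t • m) = t • toFun m

/-! The retract of an abelian heap at an element -/

section Retract

variable {H : Type u} [AbHeap H]

/-- The `e`-retract of an abelian heap: the abelian group with `a + b = [a, e, b]`, neutral
element `e` and `-a = [e, a, e]`. -/
abbrev retract (e : H) : AddCommGroup H where
  add a b := br a e b
  zero := e
  neg a := br e a e
  add_assoc a b c := br_assoc a e b e c
  zero_add a := br_left a e
  add_zero a := br_right a e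
  add_comm a b := br_comm a e b
  neg_add_cancel a := by
    change br (br e a e) e a = e
    rw [br_assoc, br_left, br_right]
  nsmul := @nsmulRec H ⟨e⟩ ⟨fun a b => br a e b⟩
  zsmul := @zsmulRec H ⟨e⟩ ⟨fun a b => br a e b⟩ ⟨fun a => br e a e⟩
    (@nsmulRec H ⟨e⟩ ⟨fun a b => br a e b⟩)

theorem retract_br (e a b c : H) :
    br a b c = (letI := retract e; a - b + c) := by
  letI := retract e
  rw [sub_eq_add_neg]
  change br a b c = br (br a e (br e b e)) e c
  rw [br_assoc, br_assoc, br_left, ← br_assoc, br_right]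

/-- The transposition rule. -/
theorem br_transpose (a b c d e f g h i : H) :
    br (br a b c) (br d e f) (br g h i) = br (br a d g) (br b e h) (br c f i) := by
  letI := retract a
  simp only [retract_br a]
  abel

end Retract

/-- Heaps of module homomorphisms, with the pointwise operation. -/
instance ModHom.instAbHeap {T M N : Type u} [Truss T] [AbHeap M] [TrussModule T M]
    [AbHeap N] [TrussModule T N] : AbHeap (ModHom T M N) where
  br f g h :=
    { toFun := fun m => br (f.toFun m) (g.toFun m) (h.toFun m)
      map_br := fun a b c => by
        rw [f.map_br, g.map_br, h.map_br, br_transpose]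
      map_smul := fun t m => by
        rw [f.map_smul, g.map_smul, h.map_smul, TrussModule.smul_br] }
  br_assoc _ _ _ _ _ := ModHom.ext (funext fun _ => br_assoc _ _ _ _ _)
  br_right _ _ := ModHom.ext (funext fun _ => br_right _ _)
  br_left _ _ := ModHom.ext (funext fun _ => br_left _ _)
  br_comm _ _ _ := ModHom.ext (funext fun _ => br_comm _ _ _)

/-! The categories of abelian heaps and of modules over a truss, and the hom-functors -/

/-- The category of abelian heaps. -/
structure AhCat : Type (u + 1) where
  carrier : Type u
  [str : AbHeap carrier]

attribute [instance] AhCat.str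

instance AhCat.instCategory : Category AhCat.{u} where
  Hom H K := HeapHom H.carrier K.carrier
  id _ := ⟨fun x => x, fun _ _ _ => rfl⟩
  comp f g := ⟨fun x => g.toFun (f.toFun x), fun _ _ _ => by rw [f.map_br, g.map_br]⟩

/-- The category of all left modules over a truss. -/
structure TModCat (T : Type u) [Truss T] : Type (u + 1) where
  carrier : Type u
  [heap : AbHeap carrier]
  [mod : TrussModule T carrier]

attribute [instance] TModCat.heap TModCat.mod

instance TModCat.instCategory (T : Type u) [Truss T] : Category (TModCat T) where
  Hom M N := ModHom T M.carrier N.carrier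
  id _ := ⟨fun x => x, fun _ _ _ => rfl, fun _ _ => rfl⟩
  comp f g := ⟨fun x => g.toFun (f.toFun x), fun _ _ _ => by rw [f.map_br, g.map_br],
    fun _ _ => by rw [f.map_smul, g.map_smul]⟩

/-- The functor `Hom_T(P, -)` from `T`-modules to abelian heaps. -/
def homFunctor (T P : Type u) [Truss T] [AbHeap P] [TrussModule T P] :
    TModCat T ⥤ AhCat.{u} where
  obj M := ⟨ModHom T P M.carrier⟩
  map {M N} g :=
    { toFun := fun f => (TModCat.instCategory T).comp (X := ⟨P⟩) (Y := M) (Z := N) f g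
      map_br := fun _ _ _ => ModHom.ext (funext fun _ => ModHom.map_br g _ _ _) }

/-! Projective, finitely generated and tiny modules over a truss -/

section Properties

variable (T P : Type u) [Truss T] [AbHeap P] [TrussModule T P]

/-- `P` is projective: `T`-linear maps from `P` lift along surjective `T`-linear maps. -/
def IsProjective : Prop :=
  ∀ (M N : Type u) [AbHeap M] [TrussModule T M] [AbHeap N] [TrussModule T N]
    (p : ModHom T M N) (f : ModHom T P N), Function.Surjective p.toFun →
      ∃ g : ModHom T P M, ∀ x, p.toFun (g.toFun x) = f.toFun x

/-- `P` is finitely generated: some finite subset lies in no proper submodule, a submodule being a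
subset closed under the heap operation and the action. -/
def IsFG : Prop :=
  ∃ S : Set P, S.Finite ∧ ∀ N : Set P, S ⊆ N →
    (∀ a ∈ N, ∀ b ∈ N, ∀ c ∈ N, br a b c ∈ N) → (∀ (t : T), ∀ a ∈ N, t • a ∈ N) → N = Set.univ

/-- `P` is tiny (small-projective): it is finitely generated and `Hom_T(P, -)` is right exact,
that is, preserves finite colimits. -/
def IsTiny : Prop :=
  IsFG T P ∧ Limits.PreservesFiniteColimits (homFunctor T P)

end Properties

/-! Modules over rings without a unit being required -/

/-- Left modules over a ring that need not have an identity; when it has one, it need not act as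
the identity. -/
class RingModule (R M : Type u) [NonUnitalRing R] [AddCommGroup M] [SMul R M] : Prop where
  smul_smul' : ∀ (r s : R) (m : M), r • (s • m) = (r * s) • m
  add_smul' : ∀ (r s : R) (m : M), (r + s) • m = r • m + s • m
  smul_add' : ∀ (r : R) (m n : M), r • (m + n) = r • m + r • n

instance (R M : Type u) [Ring R] [AddCommGroup M] [Module R M] : RingModule R M where
  smul_smul' r s m := _root_.smul_smul r s m
  add_smul' r s m := _root_.add_smul r s m
  smul_add' r m n := _root_.smul_add r m n

namespace RingModule

variable (R P : Type u) [NonUnitalRing R] [AddCommGroup P] [SMul R P] [RingModule R P]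

theorem zero_smul' (m : P) : (0 : R) • m = 0 := by
  have h := add_smul' (0 : R) 0 m
  rw [add_zero] at h
  exact left_eq_add.mp h

theorem smul_neg' (r : R) (m : P) : r • (-m) = -(r • m) := by
  have h0 : r • (0 : P) = 0 := by
    have h := smul_add' r (0 : P) 0
    rw [add_zero] at h
    exact left_eq_add.mp h
  rw [eq_neg_iff_add_eq_zero, ← smul_add', neg_add_cancel, h0]

theorem neg_smul' (r : R) (m : P) : (-r) • m = -(r • m) := by
  rw [eq_neg_iff_add_eq_zero, ← add_smul', neg_add_cancel, zero_smul']

/-- Projectivity in the category of all `R`-modules: linear maps from `P` lift along surjective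
linear maps. -/
def IsProjective : Prop :=
  ∀ (M N : Type u) [AddCommGroup M] [SMul R M] [RingModule R M]
    [AddCommGroup N] [SMul R N] [RingModule R N]
    (p : M →+ N) (_ : ∀ (r : R) (m : M), p (r • m) = r • p m)
    (f : P →+ N) (_ : ∀ (r : R) (x : P), f (r • x) = r • f x), Function.Surjective p →
      ∃ g : P →+ M, (∀ (r : R) (x : P), g (r • x) = r • g x) ∧ ∀ x, p (g x) = f x

/-- Finite generation: some finite subset lies in no proper submodule, a submodule being an
additive subgroup closed under the action. -/
def IsFG : Prop :=
  ∃ S : Set P, S.Finite ∧ ∀ N : AddSubgroup P, S ⊆ N →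
    (∀ (r : R), ∀ x ∈ N, r • x ∈ N) → N = ⊤

end RingModule

/-! The truss of a ring and the truss module of a module over a ring -/

/-- A copy of an abelian group `G`, viewed as an abelian heap with `[a, b, c] = a - b + c`.
For a ring `R`, the copy `HeapOf R` is a truss with the multiplication of `R`; for an `R`-module `P`,
the copy `HeapOf P` is an `HeapOf R`-module with the action of `R`. -/
def HeapOf (G : Type u) : Type u := G

/-- The identity map to the copy. -/
def HeapOf.of {G : Type u} (g : G) : HeapOf G := g

/-- The identity map from the copy. -/
def HeapOf.val {G : Type u} (g : HeapOf G) : G := g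

instance HeapOf.instAbHeap (G : Type u) [AddCommGroup G] : AbHeap (HeapOf G) where
  br a b c := HeapOf.of (a.val - b.val + c.val)
  br_assoc a b c d e := by
    change a.val - b.val + c.val - d.val + e.val = a.val - b.val + (c.val - d.val + e.val)
    abel
  br_right a b := by
    change a.val - b.val + b.val = a.val
    abel
  br_left a b := by
    change b.val - b.val + a.val = a.val
    abel
  br_comm a b c := by
    change a.val - b.val + c.val = c.val - b.val + a.val
    abel

instance HeapOf.instTruss (R : Type u) [NonUnitalRing R] : Truss (HeapOf R) where
  mul a b := HeapOf.of (a.val * b.val)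
  mul_assoc a b c := mul_assoc a.val b.val c.val
  mul_br s a b c := by
    change s.val * (a.val - b.val + c.val) = s.val * a.val - s.val * b.val + s.val * c.val
    rw [mul_add, mul_sub]
  br_mul a b c s := by
    change (a.val - b.val + c.val) * s.val = a.val * s.val - b.val * s.val + c.val * s.val
    rw [add_mul, sub_mul]

instance HeapOf.instTrussModule (R P : Type u) [NonUnitalRing R] [AddCommGroup P] [SMul R P]
    [RingModule R P] : TrussModule (HeapOf R) (HeapOf P) where
  smul r p := HeapOf.of (r.val • p.val)
  smul_smul' r s p := RingModule.smul_smul' r.val s.val p.val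
  br_smul a b c p := by
    change (a.val - b.val + c.val) • p.val = a.val • p.val - b.val • p.val + c.val • p.val
    rw [RingModule.add_smul', sub_eq_add_neg, RingModule.add_smul', RingModule.neg_smul',
      ← sub_eq_add_neg]
  smul_br r a b c := by
    change r.val • (a.val - b.val + c.val) = r.val • a.val - r.val • b.val + r.val • c.val
    rw [RingModule.smul_add', sub_eq_add_neg, RingModule.smul_add', RingModule.smul_neg',
      ← sub_eq_add_neg]

/-! The absorber construction -/

/-- The absorbers of a `T`-module. -/
def absorbers (T M : Type u) [Truss T] [AbHeap M] [TrussModule T M] : Set M :=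
  {m | ∀ t : T, t • m = m}

section Absorber

variable (R P : Type u) [NonUnitalRing R] [AbHeap P] [TrussModule (HeapOf R) P]

/-- The absorber `0 • c`. -/
def zeroAct (c : P) : P := (HeapOf.of (0 : R)) • c

theorem zeroAct_mem (c : P) : zeroAct R P c ∈ absorbers (HeapOf R) P := by
  intro t
  unfold zeroAct
  rw [TrussModule.smul_smul']
  congr 1
  exact mul_zero t.val

theorem br_mem_absorbers {a b c : P} (ha : a ∈ absorbers (HeapOf R) P) (hb : b ∈ absorbers (HeapOf R) P)
    (hc : c ∈ absorbers (HeapOf R) P) : br a b c ∈ absorbers (HeapOf R) P := by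
  intro t
  rw [TrussModule.smul_br, ha t, hb t, hc t]

/-- The sub-heap relation of the absorbers: `a ∼ b` iff `[a, b, s]` is an absorber for some
absorber `s`. It is extended to `Option P`, in which `none` is one more representative of the class
of all absorbers; the extra representative changes the quotient only if `P` is empty, where it
makes it a one-element set instead of the empty set. -/
def absRel : Option P → Option P → Prop
  | none, none => True
  | none, some b => b ∈ absorbers (HeapOf R) P
  | some a, none => a ∈ absorbers (HeapOf R) P
  | some a, some b => ∃ s ∈ absorbers (HeapOf R) P, br a b s ∈ absorbers (HeapOf R) P

/-- Absorbers as a subgroup of the retract at an absorber. -/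
abbrev absSubgroup (c : P) : letI := retract (zeroAct R P c); AddSubgroup P :=
  letI := retract (zeroAct R P c)
  { carrier := absorbers (HeapOf R) P
    add_mem' := fun ha hb => br_mem_absorbers R P ha (zeroAct_mem R P c) hb
    zero_mem' := zeroAct_mem R P c
    neg_mem' := fun ha => br_mem_absorbers R P (zeroAct_mem R P c) ha (zeroAct_mem R P c) }

/-- Values of the representatives, with the extra one sent to an absorber. -/
def absVal (c : P) : Option P → P
  | none => zeroAct R P c
  | some a => a

theorem absRel_iff (c : P) (x y : Option P) : absRel R P x y ↔
    (letI := retract (zeroAct R P c); absVal R P c x - absVal R P c y ∈ absSubgroup R P c) := by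
  letI := retract (zeroAct R P c)
  have hz : zeroAct R P c = 0 := rfl
  have hm : ∀ a, a ∈ absorbers (HeapOf R) P ↔ a ∈ absSubgroup R P c := fun _ => Iff.rfl
  rcases x with _ | a <;> rcases y with _ | b <;> simp only [absRel, absVal, hm, hz]
  · simp [zero_mem]
  · simp
  · simp
  · constructor
    · rintro ⟨s, hs, h⟩
      rw [retract_br (zeroAct R P c)] at h
      exact (AddSubgroup.add_mem_cancel_right _ hs).1 h
    · intro h
      refine ⟨0, zero_mem _, ?_⟩
      rw [retract_br (zeroAct R P c)]
      exact add_mem h (zero_mem _)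

theorem absRel_equivalence : Equivalence (absRel R P) := by
  by_cases hP : Nonempty P
  · obtain ⟨c⟩ := hP
    letI := retract (zeroAct R P c)
    refine ⟨fun x => ?_, fun {x y} h => ?_, fun {x y z} h k => ?_⟩ <;>
      simp only [absRel_iff R P c] at *
    · rw [sub_self]; exact zero_mem _
    · rw [← neg_sub]; exact neg_mem h
    · rw [← sub_add_sub_cancel]; exact add_mem h k
  · have h : ∀ x : Option P, x = none := by
      rintro (_ | a)
      · rfl
      · exact absurd ⟨a⟩ hP
    refine ⟨fun x => ?_, fun {x y} _ => ?_, fun {x y z} _ _ => ?_⟩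
    · rw [h x]; trivial
    · rw [h x, h y]; trivial
    · rw [h x, h z]; trivial

abbrev absSetoid : Setoid (Option P) := ⟨absRel R P, absRel_equivalence R P⟩

/-- The underlying set of the `R`-module `P_Abs`: the quotient of `P` by its sub-heap of absorbers
(and a one-element set if `P` is empty). -/
def Abs : Type u := Quotient (absSetoid R P)

/-- Addition on representatives: `a + b = [a, 0 • a, b]`, where `0 • a` is an absorber. -/
def absAdd : Option P → Option P → Option P
  | none, y => y
  | some a, none => some a
  | some a, some b => some (br a (zeroAct R P a) b)

/-- Negation on representatives: `-a = [0 • a, a, 0 • a]`. -/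
def absNeg : Option P → Option P
  | none => none
  | some a => some (br (zeroAct R P a) a (zeroAct R P a))

/-- The action on representatives. -/
def absSMul (r : R) : Option P → Option P
  | none => none
  | some a => some (HeapOf.of r • a)

theorem absVal_add (c : P) (x y : Option P) : letI := retract (zeroAct R P c);
    absVal R P c (absAdd R P x y) - (absVal R P c x + absVal R P c y) ∈ absSubgroup R P c := by
  letI := retract (zeroAct R P c)
  have hz : zeroAct R P c = 0 := rfl
  rcases x with _ | a
  · simp only [absAdd, absVal, hz, zero_add, sub_self]; exact zero_mem _
  · rcases y with _ | b
    · simp only [absAdd, absVal, hz, add_zero, sub_self]; exact zero_mem _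
    · simp only [absAdd, absVal]
      rw [retract_br (zeroAct R P c)]
      have : a - zeroAct R P a + b - (a + b) = -zeroAct R P a := by abel
      rw [this]
      exact neg_mem (show zeroAct R P a ∈ absSubgroup R P c from zeroAct_mem R P a)

theorem absVal_neg (c : P) (x : Option P) : letI := retract (zeroAct R P c);
    absVal R P c (absNeg R P x) - (-absVal R P c x) ∈ absSubgroup R P c := by
  letI := retract (zeroAct R P c)
  have hz : zeroAct R P c = 0 := rfl
  rcases x with _ | a
  · simp only [absNeg, absVal, hz, neg_zero, sub_self]; exact zero_mem _
  · simp only [absNeg, absVal]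
    rw [retract_br (zeroAct R P c)]
    have : zeroAct R P a - a + zeroAct R P a - -a = zeroAct R P a + zeroAct R P a := by abel
    rw [this]
    have h : zeroAct R P a ∈ absSubgroup R P c := zeroAct_mem R P a
    exact add_mem h h

theorem absVal_smul (c : P) (r : R) (x : Option P) :
    absVal R P c (absSMul R P r x) = HeapOf.of r • absVal R P c x := by
  rcases x with _ | a
  · exact (zeroAct_mem R P c (HeapOf.of r)).symm
  · rfl

/-- The action is additive on the retract at an absorber. -/
theorem smul_retract_add (c : P) (r : HeapOf R) (a b : P) : letI := retract (zeroAct R P c);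
    r • (a + b) = r • a + r • b := by
  change r • br a (zeroAct R P c) b = br (r • a) (zeroAct R P c) (r • b)
  rw [TrussModule.smul_br, zeroAct_mem R P c r]

theorem smul_retract_sub (c : P) (r : HeapOf R) (a b : P) : letI := retract (zeroAct R P c);
    r • (a - b) = r • a - r • b := by
  letI := retract (zeroAct R P c)
  have h := smul_retract_add R P c r (a - b) b
  rw [sub_add_cancel] at h
  exact eq_sub_of_add_eq h.symm

instance : Zero (Abs R P) := ⟨Quotient.mk (absSetoid R P) none⟩

instance : Add (Abs R P) := ⟨Quotient.map₂ (absAdd R P) (by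
  intro x x' hx y y' hy
  change absRel R P x x' at hx
  change absRel R P y y' at hy
  change absRel R P _ _
  by_cases hP : Nonempty P
  · obtain ⟨c⟩ := hP
    letI := retract (zeroAct R P c)
    rw [absRel_iff R P c] at *
    have h := add_mem (sub_mem (absVal_add R P c x y) (absVal_add R P c x' y')) (add_mem hx hy)
    convert h using 1
    abel
  · have h : ∀ x : Option P, x = none := by
      rintro (_ | a)
      · rfl
      · exact absurd ⟨a⟩ hP
    rw [h x, h x', h y, h y']
    trivial)⟩

instance : Neg (Abs R P) := ⟨Quotient.map (absNeg R P) (by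
  intro x x' hx
  change absRel R P x x' at hx
  change absRel R P _ _
  by_cases hP : Nonempty P
  · obtain ⟨c⟩ := hP
    letI := retract (zeroAct R P c)
    rw [absRel_iff R P c] at *
    have h := sub_mem (sub_mem (absVal_neg R P c x) (absVal_neg R P c x')) hx
    convert h using 1
    abel
  · have h : ∀ x : Option P, x = none := by
      rintro (_ | a)
      · rfl
      · exact absurd ⟨a⟩ hP
    rw [h x, h x']
    trivial)⟩

instance : SMul R (Abs R P) := ⟨fun r => Quotient.map (absSMul R P r) (by
  intro x x' hx
  change absRel R P x x' at hx
  change absRel R P _ _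
  by_cases hP : Nonempty P
  · obtain ⟨c⟩ := hP
    letI := retract (zeroAct R P c)
    rw [absRel_iff R P c] at *
    rw [absVal_smul, absVal_smul, ← smul_retract_sub]
    change _ ∈ absorbers (HeapOf R) P
    intro t
    have h : ∀ t, t • _ = _ := hx
    rw [h, h]
  · have h : ∀ x : Option P, x = none := by
      rintro (_ | a)
      · rfl
      · exact absurd ⟨a⟩ hP
    rw [h x, h x']
    trivial)⟩

/-- Two representatives are identified if their values differ by an absorber. -/
theorem abs_sound (x y : Option P)
    (h : ∀ c : P, letI := retract (zeroAct R P c);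
      absVal R P c x - absVal R P c y ∈ absSubgroup R P c) :
    (Quotient.mk (absSetoid R P) x) = Quotient.mk (absSetoid R P) y := by
  apply Quotient.sound
  change absRel R P x y
  rcases x with _ | a
  · rcases y with _ | b
    · trivial
    · exact (absRel_iff R P b _ _).2 (h b)
  · exact (absRel_iff R P a _ _).2 (h a)

/-- The group `G(P / Abs(P); Abs(P))`. -/
instance : AddCommGroup (Abs R P) where
  add_assoc := by
    rintro ⟨x⟩ ⟨y⟩ ⟨z⟩
    refine abs_sound R P (absAdd R P (absAdd R P x y) z) (absAdd R P x (absAdd R P y z))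
      fun c => ?_
    letI := retract (zeroAct R P c)
    have h := sub_mem (add_mem (absVal_add R P c (absAdd R P x y) z) (absVal_add R P c x y))
      (add_mem (absVal_add R P c x (absAdd R P y z)) (absVal_add R P c y z))
    convert h using 1
    abel
  zero_add := by
    rintro ⟨x⟩
    rfl
  add_zero := by
    rintro ⟨_ | a⟩ <;> rfl
  add_comm := by
    rintro ⟨x⟩ ⟨y⟩
    refine abs_sound R P (absAdd R P x y) (absAdd R P y x) fun c => ?_
    letI := retract (zeroAct R P c)
    have h := sub_mem (absVal_add R P c x y) (absVal_add R P c y x)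
    convert h using 1
    abel
  neg_add_cancel := by
    rintro ⟨x⟩
    refine abs_sound R P (absAdd R P (absNeg R P x) x) none fun c => ?_
    letI := retract (zeroAct R P c)
    have hz : absVal R P c none = 0 := rfl
    have h := add_mem (absVal_add R P c (absNeg R P x) x) (absVal_neg R P c x)
    convert h using 1
    rw [hz]
    abel
  nsmul := nsmulRec
  zsmul := zsmulRec

/-- The `R`-module `P_Abs`. -/
instance : RingModule R (Abs R P) where
  smul_smul' := by
    rintro r s ⟨_ | a⟩
    · rfl
    · exact congrArg (fun b => Quotient.mk (absSetoid R P) (some b))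
        (TrussModule.smul_smul' (HeapOf.of r) (HeapOf.of s) a)
  add_smul' := by
    rintro r s ⟨x⟩
    refine abs_sound R P (absSMul R P (r + s) x) (absAdd R P (absSMul R P r x) (absSMul R P s x))
      fun c => ?_
    letI := retract (zeroAct R P c)
    have h := neg_mem (absVal_add R P c (absSMul R P r x) (absSMul R P s x))
    have h0 : zeroAct R P (absVal R P c x) ∈ absSubgroup R P c := zeroAct_mem R P _
    have e : HeapOf.of (r + s) • absVal R P c x = HeapOf.of r • absVal R P c x
        - zeroAct R P (absVal R P c x) + HeapOf.of s • absVal R P c x := by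
      rw [← retract_br (zeroAct R P c), zeroAct, ← TrussModule.br_smul]
      congr 1
      change r + s = r - 0 + s
      rw [sub_zero]
    convert sub_mem h h0 using 1
    rw [absVal_smul, absVal_smul, absVal_smul, e]
    abel
  smul_add' := by
    rintro r ⟨x⟩ ⟨y⟩
    refine abs_sound R P (absSMul R P r (absAdd R P x y))
      (absAdd R P (absSMul R P r x) (absSMul R P r y)) fun c => ?_
    letI := retract (zeroAct R P c)
    have h := absVal_add R P c (absSMul R P r x) (absSMul R P r y)
    have k := absVal_add R P c x y
    have k' : HeapOf.of r • (absVal R P c (absAdd R P x y) - (absVal R P c x + absVal R P c y))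
        ∈ absSubgroup R P c := by
      intro t
      have hk : ∀ t : HeapOf R, t • (absVal R P c (absAdd R P x y)
        - (absVal R P c x + absVal R P c y)) = _ := k
      rw [hk, hk]
    rw [smul_retract_sub, smul_retract_add] at k'
    convert sub_mem k' h using 1
    rw [absVal_smul, absVal_smul, absVal_smul]
    abel

end Absorber

/-! Unital modules -/

/-- A module over the unital truss of a ring with identity is unital if the identity acts as the
identity. -/
class IsUnital (R P : Type u) [Ring R] [AbHeap P] [TrussModule (HeapOf R) P] : Prop where
  one_smul' : ∀ p : P, (HeapOf.of (1 : R)) • p = p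

instance IsUnital.instModule (R P : Type u) [Ring R] [AbHeap P] [TrussModule (HeapOf R) P]
    [IsUnital R P] : Module R (Abs R P) where
  one_smul := by
    rintro ⟨_ | a⟩
    · rfl
    · exact congrArg (fun b => Quotient.mk (absSetoid R P) (some b)) (IsUnital.one_smul' (R := R) a)
  mul_smul r s x := (RingModule.smul_smul' r s x).symm
  smul_zero r := by rfl
  smul_add := RingModule.smul_add'
  add_smul := RingModule.add_smul'
  zero_smul := RingModule.zero_smul' R (Abs R P)

end TrussMod

/-! An absorber $a$ satisfies $a = 0\cdot a$, so every map to the truss module of a ring module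
sends it to $0$. Such maps therefore factor through $P_{\mathrm{Abs}}$ (`absLift`), which carries
the lifting property over to $P_{\mathrm{Abs}}$; generators simply pass to the quotient.

Tiny modules are projective (`IsTiny.isProjective`): a surjection is the coequalizer of its kernel
pair, $\mathrm{Hom}(P,-)$ preserves it, and coequalizers of heaps are surjective.

The substantial claim is that $\mathrm T(P)$ is tiny for $P$ finitely generated and projective.
Since $R$ need not have an identity, pass to $S = \mathbb Z\oplus R$ (`UHull`), over which $P$ is
unital, finitely generated and projective, hence has a dual basis: $p = \sum_i \xi_i(p)\,x_i$. Every
$\mathrm T(R)$-module carries a natural action of $S$ (`uact`), computed at $m$ in the retract at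
the absorber $0\cdot m$. With $P^* = \mathrm{Hom}_S(P,S)$, the functor $\mathrm{Hom}(\mathrm
T(P),-)$ is then left adjoint to $X\mapsto \mathrm{Heap}(P^*,X)$: $\Psi$ corresponds to
$m\mapsto(\alpha\mapsto\Psi(\alpha(-)m))$, and $F$ to $h\mapsto\sum_i F(h(x_i))(\xi_i)$, summed in
the retract at $F(h(0))(0)$. So it preserves all colimits.

In the unital case it remains to see that projectivity and finite generation agree with the usual
notions. -/

namespace TrussMod

open AbHeap

/-! The retract as a type synonym, integer multiples and finite sums in a heap -/

section Ret

variable {H K : Type u} [AbHeap H] [AbHeap K]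

/-- A copy of the heap `H` that carries the group structure of the `e`-retract. -/
def Ret (_e : H) : Type u := H

instance (e : H) : AddCommGroup (Ret e) := @retract H _ e

/-- The identity map from a heap to its `e`-retract. -/
def toRet (e : H) : H ≃ Ret e := Equiv.refl H

/-- Turns a heap identity into one in an abelian group with a freely chosen base point; the
identities for `uact` are then settled by `abel`. -/
theorem toRet_br (e a b c : H) : toRet e (br a b c) = toRet e a - toRet e b + toRet e c :=
  retract_br e a b c

@[simp] theorem toRet_self (e : H) : toRet e e = 0 := rfl

theorem toRet_symm_add (e : H) (x y : Ret e) :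
    (toRet e).symm (x + y) = br ((toRet e).symm x) e ((toRet e).symm y) := rfl

/-- A homomorphism of heaps is a homomorphism of retracts. -/
def HeapHom.retHom (f : HeapHom H K) (e : H) : Ret e →+ Ret (f.toFun e) :=
  AddMonoidHom.mk' (fun x => toRet _ (f.toFun ((toRet e).symm x))) fun x y => by
    rw [toRet_symm_add, f.map_br, toRet_br]
    simp

theorem HeapHom.retHom_toRet (f : HeapHom H K) (e x : H) :
    f.retHom e (toRet e x) = toRet (f.toFun e) (f.toFun x) := rfl

/-- The `n`-fold multiple of `m` in the `e`-retract. -/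
def zmulAt (e : H) (n : ℤ) (m : H) : H := (toRet e).symm (n • toRet e m)

theorem HeapHom.map_zmulAt (f : HeapHom H K) (e : H) (n : ℤ) (m : H) :
    f.toFun (zmulAt e n m) = zmulAt (f.toFun e) n (f.toFun m) := by
  apply (toRet (f.toFun e)).injective
  rw [← f.retHom_toRet, zmulAt, zmulAt, Equiv.apply_symm_apply, Equiv.apply_symm_apply,
    map_zsmul, f.retHom_toRet]

/-- Change of base point: translation by $e$ is a group homomorphism from the retract at $e$ to the
one at $b$. -/
theorem toRet_zmulAt (b e : H) (n : ℤ) (m : H) :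
    toRet b (zmulAt e n m) = n • (toRet b m - toRet b e) + toRet b e := by
  let φ : Ret e →+ Ret b :=
    AddMonoidHom.mk' (fun x => toRet b ((toRet e).symm x) - toRet b e) fun x y => by
      rw [toRet_symm_add, toRet_br]
      abel
  have h := map_zsmul φ n (toRet e m)
  exact sub_eq_iff_eq_add.1 h

theorem zmulAt_heapOf {G : Type u} [AddCommGroup G] (n : ℤ) (g : G) :
    zmulAt (HeapOf.of (0 : G)) n (HeapOf.of g) = HeapOf.of (n • g) := by
  let φ : G →+ Ret (HeapOf.of (0 : G)) :=
    AddMonoidHom.mk' (fun x => toRet _ (HeapOf.of x)) fun x y => by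
      change x + y = x - 0 + y
      rw [sub_zero]
  exact (map_zsmul φ n g).symm

variable {ι : Type} [Fintype ι]

/-- The sum of a finite family in the `e`-retract. -/
def sumAt (e : H) (x : ι → H) : H := (toRet e).symm (∑ i, toRet e (x i))

theorem HeapHom.map_sumAt (f : HeapHom H K) (e : H) (x : ι → H) :
    f.toFun (sumAt e x) = sumAt (f.toFun e) fun i => f.toFun (x i) := by
  apply (toRet (f.toFun e)).injective
  rw [← f.retHom_toRet, sumAt, sumAt, Equiv.apply_symm_apply, Equiv.apply_symm_apply,
    map_sum]
  rfl

theorem sumAt_heapOf {G : Type u} [AddCommGroup G] (x : ι → G) :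
    sumAt (HeapOf.of (0 : G)) (fun i => HeapOf.of (x i)) = HeapOf.of (∑ i, x i) := by
  let φ : G →+ Ret (HeapOf.of (0 : G)) :=
    AddMonoidHom.mk' (fun x => toRet _ (HeapOf.of x)) fun x y => by
      change x + y = x - 0 + y
      rw [sub_zero]
  exact (map_sum φ x Finset.univ).symm

/-- Heaps of heap homomorphisms, with the pointwise operation. -/
instance HeapHom.instAbHeap : AbHeap (HeapHom H K) where
  br f g h :=
    { toFun := fun m => br (f.toFun m) (g.toFun m) (h.toFun m)
      map_br := fun a b c => by rw [f.map_br, g.map_br, h.map_br, br_transpose] }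
  br_assoc _ _ _ _ _ := HeapHom.ext (funext fun _ => br_assoc _ _ _ _ _)
  br_right _ _ := HeapHom.ext (funext fun _ => br_right _ _)
  br_left _ _ := HeapHom.ext (funext fun _ => br_left _ _)
  br_comm _ _ _ := HeapHom.ext (funext fun _ => br_comm _ _ _)

/-- Evaluation of heap homomorphisms at an element. -/
def HeapHom.eval (x : H) : HeapHom (HeapHom H K) K := ⟨fun f => f.toFun x, fun _ _ _ => rfl⟩

/-- Composition of heap homomorphisms. -/
def HeapHom.comp {L : Type u} [AbHeap L] (g : HeapHom K L) (f : HeapHom H K) : HeapHom H L :=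
  ⟨fun x => g.toFun (f.toFun x), fun _ _ _ => by rw [f.map_br, g.map_br]⟩

end Ret

section ModHom

variable {T M N : Type u} [Truss T] [AbHeap M] [TrussModule T M] [AbHeap N] [TrussModule T N]

/-- The underlying heap homomorphism of a module homomorphism. -/
def ModHom.toHeapHom (f : ModHom T M N) : HeapHom M N := ⟨f.toFun, f.map_br⟩

/-- Evaluation of module homomorphisms at an element. -/
def ModHom.eval (x : M) : HeapHom (ModHom T M N) N := ⟨fun f => f.toFun x, fun _ _ _ => rfl⟩

/-- Composition of module homomorphisms. -/
def ModHom.comp {L : Type u} [AbHeap L] [TrussModule T L] (g : ModHom T N L) (f : ModHom T M N) :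
    ModHom T M L :=
  ⟨fun x => g.toFun (f.toFun x), fun _ _ _ => by rw [f.map_br, g.map_br],
    fun _ _ => by rw [f.map_smul, g.map_smul]⟩

/-- The action of a fixed element of the truss. -/
def TrussModule.smulHom (t : T) : HeapHom M M := ⟨fun m => t • m, smul_br t⟩

end ModHom

/-! The unitization of a ring -/

/-- The ring `ℤ ⊕ R` obtained from the ring `R` by adjoining an identity. -/
def UHull (R : Type u) [NonUnitalRing R] : Type u := Unitization ℤ R

namespace UHull

variable {R : Type u} [NonUnitalRing R]

instance : Ring (UHull R) := inferInstanceAs (Ring (Unitization ℤ R))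

/-- The integral component. -/
def fst (ρ : UHull R) : ℤ := (show Unitization ℤ R from ρ).toProd.1

/-- The component in the original ring. -/
def snd (ρ : UHull R) : R := (show Unitization ℤ R from ρ).toProd.2

/-- The inclusion of the original ring. -/
def inr (r : R) : UHull R := (Unitization.inr r : Unitization ℤ R)

theorem fst_add (ρ σ : UHull R) : (ρ + σ).fst = ρ.fst + σ.fst := rfl
theorem snd_add (ρ σ : UHull R) : (ρ + σ).snd = ρ.snd + σ.snd := rfl
theorem fst_neg (ρ : UHull R) : (-ρ).fst = -ρ.fst := rfl
theorem snd_neg (ρ : UHull R) : (-ρ).snd = -ρ.snd := rfl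
theorem fst_mul (ρ σ : UHull R) : (ρ * σ).fst = ρ.fst * σ.fst := rfl
theorem snd_mul (ρ σ : UHull R) :
    (ρ * σ).snd = ρ.fst • σ.snd + σ.fst • ρ.snd + ρ.snd * σ.snd := rfl
theorem fst_inr (r : R) : (inr r).fst = 0 := rfl
theorem snd_inr (r : R) : (inr r).snd = r := rfl
theorem inr_zero : inr (0 : R) = 0 := rfl

theorem inr_add (r s : R) : inr (r + s) = inr r + inr s := Unitization.inr_add ℤ r s

theorem inr_sub (r s : R) : inr (r - s) = inr r - inr s := Unitization.inr_sub ℤ r s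

theorem inr_mul (r s : R) : inr (r * s) = inr r * inr s := Unitization.inr_mul ℤ r s

theorem zsmul_one_add_inr (ρ : UHull R) : ρ.fst • (1 : UHull R) + inr ρ.snd = ρ := by
  have h : ρ.fst • (1 : UHull R) = (Unitization.inl ρ.fst : Unitization ℤ R) := by
    have h := map_zsmul (Unitization.inlRingHom ℤ R) ρ.fst 1
    rw [smul_eq_mul, mul_one, map_one] at h
    exact h.symm
  rw [h]
  exact Unitization.inl_fst_add_inr_snd_eq (R := ℤ) (A := R) ρ

theorem smul_eq {P : Type u} [AddCommGroup P] [Module (UHull R) P] (ρ : UHull R) (p : P) :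
    ρ • p = ρ.fst • p + inr ρ.snd • p := by
  conv_lhs => rw [← zsmul_one_add_inr ρ, add_smul, smul_assoc, one_smul]

end UHull

/-! The action of the unitization of a ring on modules over its truss -/

section UAct

variable {R M N : Type u} [NonUnitalRing R] [AbHeap M] [TrussModule (HeapOf R) M]
  [AbHeap N] [TrussModule (HeapOf R) N]

theorem zeroAct_smul (r : HeapOf R) (m : M) : zeroAct R M (r • m) = zeroAct R M m := by
  unfold zeroAct
  rw [TrussModule.smul_smul']
  congr 1
  exact zero_mul r.val

theorem zeroAct_br (a b c : M) :
    zeroAct R M (br a b c) = br (zeroAct R M a) (zeroAct R M b) (zeroAct R M c) :=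
  TrussModule.smul_br _ _ _ _

theorem ModHom.map_zeroAct (f : ModHom (HeapOf R) M N) (m : M) :
    f.toFun (zeroAct R M m) = zeroAct R N (f.toFun m) := f.map_smul _ _

/-- The action of `n + r` on `m` is `n m + r m` in the retract at `0 m`. -/
def uact (ρ : UHull R) (m : M) : M :=
  br (zmulAt (zeroAct R M m) ρ.fst m) (zeroAct R M m) (HeapOf.of ρ.snd • m)

/-- Linear maps preserve $0\cdot m$, so the base point of the retract moves along with $m$. -/
theorem ModHom.map_uact (f : ModHom (HeapOf R) M N) (ρ : UHull R) (m : M) :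
    f.toFun (uact ρ m) = uact ρ (f.toFun m) := by
  unfold uact
  rw [f.map_br, f.map_smul, f.map_zeroAct]
  congr 1
  rw [← f.map_zeroAct]
  exact f.toHeapHom.map_zmulAt _ _ _

/-- The action of $S$ seen from one fixed base point $b$, which allows actions on elements with
different absorbers to be compared. -/
theorem toRet_uact (b : M) (ρ : UHull R) (m : M) :
    toRet b (uact ρ m) =
      ρ.fst • (toRet b m - toRet b (zeroAct R M m)) + toRet b (HeapOf.of ρ.snd • m) := by
  rw [uact, toRet_br, toRet_zmulAt]
  abel

theorem uact_br (ρ : UHull R) (x y z : M) :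
    uact ρ (br x y z) = br (uact ρ x) (uact ρ y) (uact ρ z) := by
  apply (toRet x).injective
  rw [toRet_br, toRet_uact, toRet_uact, toRet_uact, toRet_uact, zeroAct_br, TrussModule.smul_br,
    toRet_br, toRet_br, toRet_br]
  simp only [smul_sub, smul_add]
  abel

theorem toRet_add_smul (b : M) (r s : R) (m : M) :
    toRet b (HeapOf.of (r + s) • m) =
      toRet b (HeapOf.of r • m) - toRet b (zeroAct R M m) + toRet b (HeapOf.of s • m) := by
  rw [← toRet_br, zeroAct, ← TrussModule.br_smul]
  congr 2
  change r + s = r - 0 + s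
  rw [sub_zero]

/-- The action of a ring element relative to the absorber of a module element is additive in the
ring element. -/
def relAct (b m : M) : R →+ Ret b :=
  AddMonoidHom.mk' (fun r => toRet b (HeapOf.of r • m) - toRet b (zeroAct R M m)) fun r s => by
    rw [toRet_add_smul]
    abel

theorem toRet_smul (b m : M) (r : R) :
    toRet b (HeapOf.of r • m) = relAct b m r + toRet b (zeroAct R M m) :=
  (sub_add_cancel _ _).symm

theorem uact_br_left (ρ σ τ : UHull R) (m : M) :
    uact (ρ - σ + τ) m = br (uact ρ m) (uact σ m) (uact τ m) := by
  apply (toRet m).injective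
  rw [toRet_br]
  simp only [toRet_uact, toRet_smul, UHull.fst_add, UHull.snd_add, UHull.fst_neg,
    UHull.snd_neg, map_add, map_neg, add_smul, neg_smul, sub_eq_add_neg]
  abel

/-- The action does not move the absorber $0\cdot m$, so iterated actions are computed in one and
the same retract; `uact_mul` depends on this. -/
theorem zeroAct_uact (ρ : UHull R) (m : M) : zeroAct R M (uact ρ m) = zeroAct R M m := by
  have h : (HeapOf.of (0 : R)) • zmulAt (zeroAct R M m) ρ.fst m
      = zmulAt (zeroAct R M (zeroAct R M m)) ρ.fst (zeroAct R M m) :=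
    (TrussModule.smulHom (HeapOf.of (0 : R))).map_zmulAt _ _ _
  have h0 : zeroAct R M (zeroAct R M m) = zeroAct R M m := zeroAct_mem R M m _
  rw [uact, zeroAct_br, zeroAct_smul, h0, br_right, zeroAct, h, h0]
  apply (toRet (zeroAct R M m)).injective
  rw [toRet_zmulAt]
  simp

theorem smul_uact (r : R) (ρ : UHull R) (m : M) :
    (HeapOf.of r) • uact ρ m = uact (UHull.inr r * ρ) m := by
  have h : (HeapOf.of r) • zmulAt (zeroAct R M m) ρ.fst m
      = zmulAt (HeapOf.of r • zeroAct R M m) ρ.fst (HeapOf.of r • m) :=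
    (TrussModule.smulHom (HeapOf.of r)).map_zmulAt _ _ _
  have h0 : (HeapOf.of r) • zeroAct R M m = zeroAct R M m := zeroAct_mem R M m _
  have hm : (HeapOf.of r) • (HeapOf.of ρ.snd) • m = HeapOf.of (r * ρ.snd) • m :=
    TrussModule.smul_smul' _ _ _
  rw [uact, TrussModule.smul_br, h, h0, hm]
  apply (toRet m).injective
  rw [toRet_uact, toRet_br, toRet_zmulAt]
  simp only [toRet_smul, UHull.fst_mul, UHull.snd_mul, UHull.fst_inr,
    UHull.snd_inr, zero_mul, zero_smul, map_add, map_zsmul, zero_add]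
  abel_nf

theorem uact_mul (ρ σ : UHull R) (m : M) : uact (ρ * σ) m = uact ρ (uact σ m) := by
  apply (toRet m).injective
  rw [toRet_uact _ ρ, smul_uact, zeroAct_uact]
  simp only [toRet_uact, toRet_smul, UHull.fst_mul, UHull.snd_mul, UHull.fst_inr,
    UHull.snd_inr, zero_mul, zero_smul, map_add, map_zsmul, zero_add, smul_sub, smul_add,
    mul_smul]
  abel

theorem uact_inr (r : R) (m : M) : uact (UHull.inr r) m = HeapOf.of r • m := by
  apply (toRet m).injective
  simp [toRet_uact, UHull.fst_inr, UHull.snd_inr]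

end UAct

end TrussMod
namespace TrussMod

open AbHeap

/-! Modules over a ring as unital modules over its unitization -/

section Unitization

variable (R P : Type u) [NonUnitalRing R] [AddCommGroup P] [SMul R P] [RingModule R P]

/-- A module over a ring is a unital module over the unitization of the ring. -/
abbrev unitizationModule : Module (UHull R) P :=
  have h0 : ∀ r : R, r • (0 : P) = 0 := fun r => by
    have h := RingModule.smul_add' r (0 : P) 0
    rw [add_zero] at h
    exact left_eq_add.mp h
  let φ (r : R) : P →+ P := AddMonoidHom.mk' (fun p => r • p) (RingModule.smul_add' r)
  let ψ (p : P) : R →+ P := AddMonoidHom.mk' (fun r => r • p) fun r s =>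
    RingModule.add_smul' r s p
  { smul := fun ρ p => ρ.fst • p + ρ.snd • p
    one_smul := fun p => by
      change (1 : ℤ) • p + (0 : R) • p = p
      rw [one_smul, RingModule.zero_smul', add_zero]
    mul_smul := fun ρ σ p => by
      change (ρ.fst * σ.fst) • p + (ρ.fst • σ.snd + σ.fst • ρ.snd + ρ.snd * σ.snd) • p =
        ρ.fst • (σ.fst • p + σ.snd • p) + ρ.snd • (σ.fst • p + σ.snd • p)
      have h1 : (ρ.fst • σ.snd) • p = ρ.fst • σ.snd • p := map_zsmul (ψ p) _ _
      have h2 : (σ.fst • ρ.snd) • p = σ.fst • ρ.snd • p := map_zsmul (ψ p) _ _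
      have h3 : ρ.snd • σ.fst • p = σ.fst • ρ.snd • p := map_zsmul (φ ρ.snd) _ _
      rw [RingModule.add_smul', RingModule.add_smul', h1, h2, ← RingModule.smul_smul',
        RingModule.smul_add', h3, mul_smul, smul_add]
      abel
    smul_zero := fun ρ => by
      change ρ.fst • (0 : P) + ρ.snd • (0 : P) = 0
      rw [smul_zero, h0, add_zero]
    smul_add := fun ρ p q => by
      change ρ.fst • (p + q) + ρ.snd • (p + q) = ρ.fst • p + ρ.snd • p + (ρ.fst • q + ρ.snd • q)
      rw [smul_add, RingModule.smul_add']
      abel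
    add_smul := fun ρ σ p => by
      change (ρ.fst + σ.fst) • p + (ρ.snd + σ.snd) • p =
        ρ.fst • p + ρ.snd • p + (σ.fst • p + σ.snd • p)
      rw [add_smul, RingModule.add_smul']
      abel
    zero_smul := fun p => by
      change (0 : ℤ) • p + (0 : R) • p = 0
      rw [zero_smul, RingModule.zero_smul', add_zero] }

theorem unitizationModule_inr_smul (r : R) (p : P) : letI := unitizationModule R P
    UHull.inr r • p = r • p := by
  change (0 : ℤ) • p + r • p = r • p
  rw [zero_smul, zero_add]

variable {R P}

/-- In $\mathrm T(P)$ the absorber $0\cdot p$ is $0$, so the retract there is the group $P$ itself.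
-/
theorem uact_heapOf [Module (UHull R) P]
    (hP : ∀ (r : R) (p : P), UHull.inr r • p = r • p) (ρ : UHull R) (p : P) :
    uact ρ (HeapOf.of p) = HeapOf.of (ρ • p) := by
  have h0 : zeroAct R (HeapOf P) (HeapOf.of p) = HeapOf.of (0 : P) :=
    RingModule.zero_smul' R P p
  rw [uact, h0, zmulAt_heapOf]
  change ρ.fst • p - 0 + ρ.snd • p = ρ • p
  rw [sub_zero, UHull.smul_eq ρ, hP]

end Unitization

/-! The dual of a module and the coinduced module -/

/-- The dual of a left module over a ring. -/
abbrev LeftDual (S P : Type u) [Ring S] [AddCommGroup P] [Module S P] : Type u := P →ₗ[S] S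

/-- The right action of a ring on the dual of a left module. -/
def LeftDual.mulRight {S P : Type u} [Ring S] [AddCommGroup P] [Module S P] (s : S) :
    LeftDual S P →+ LeftDual S P :=
  AddMonoidHom.mk' (fun α => LinearMap.toSpanSingleton S S s ∘ₗ α) fun _ _ =>
    LinearMap.comp_add _ _ _

/-- A homomorphism of groups is a homomorphism of heaps. -/
def HeapHom.ofAdd {G H : Type u} [AddCommGroup G] [AddCommGroup H] (f : G →+ H) :
    HeapHom (HeapOf G) (HeapOf H) where
  toFun g := HeapOf.of (f g.val)
  map_br a b c := by
    change f (a.val - b.val + c.val) = f a.val - f b.val + f c.val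
    rw [map_add, map_sub]

section Coinduced

variable {R P X : Type u} [NonUnitalRing R] [AddCommGroup P] [Module (UHull R) P] [AbHeap X]

/-- Heap homomorphisms from the dual of a module form a left module over the truss of the ring. -/
instance coinducedModule : TrussModule (HeapOf R) (HeapHom (HeapOf (LeftDual (UHull R) P)) X) where
  smul r φ := φ.comp (HeapHom.ofAdd (LeftDual.mulRight (UHull.inr r.val)))
  smul_smul' r s φ := by
    refine HeapHom.ext (funext fun α => congrArg φ.toFun (LinearMap.ext fun p => ?_))
    change α.val p * UHull.inr r.val * UHull.inr s.val = α.val p * UHull.inr (r.val * s.val)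
    rw [UHull.inr_mul, mul_assoc]
  br_smul a b c φ := by
    refine HeapHom.ext (funext fun α => Eq.trans (congrArg φ.toFun ?_) (φ.map_br _ _ _))
    refine LinearMap.ext fun p => ?_
    change α.val p * UHull.inr (a.val - b.val + c.val) = α.val p * UHull.inr a.val -
      α.val p * UHull.inr b.val + α.val p * UHull.inr c.val
    rw [UHull.inr_add, UHull.inr_sub, mul_add, mul_sub]
  smul_br _ _ _ _ := rfl

theorem coinduced_smul (r : R) (φ : HeapHom (HeapOf (LeftDual (UHull R) P)) X)
    (α : LeftDual (UHull R) P) : ((HeapOf.of r) • φ).toFun (HeapOf.of α) =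
      φ.toFun (HeapOf.of (LeftDual.mulRight (UHull.inr r) α)) := rfl

/-- The zero action replaces $\varphi$ by the constant map with value $\varphi(0)$. -/
theorem coinduced_zeroAct (φ : HeapHom (HeapOf (LeftDual (UHull R) P)) X)
    (α : LeftDual (UHull R) P) :
    (zeroAct R _ φ).toFun (HeapOf.of α) = φ.toFun (HeapOf.of 0) := by
  rw [zeroAct, coinduced_smul, UHull.inr_zero]
  congr 2
  exact LinearMap.ext fun p => mul_zero (α p)

/-- The heap map $\varphi$ carries multiples in the group $P^*$ to multiples in the retract at
$\varphi(0)$, which is where $S$ acts. -/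
theorem coinduced_uact (ρ : UHull R) (φ : HeapHom (HeapOf (LeftDual (UHull R) P)) X)
    (α : LeftDual (UHull R) P) :
    (uact ρ φ).toFun (HeapOf.of α) = φ.toFun (HeapOf.of (LeftDual.mulRight ρ α)) := by
  have h : (zmulAt (zeroAct R _ φ) ρ.fst φ).toFun (HeapOf.of α) =
      zmulAt ((zeroAct R _ φ).toFun (HeapOf.of α)) ρ.fst (φ.toFun (HeapOf.of α)) :=
    (HeapHom.eval (K := X) (HeapOf.of α)).map_zmulAt _ _ _
  change br ((zmulAt (zeroAct R _ φ) ρ.fst φ).toFun (HeapOf.of α))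
    ((zeroAct R _ φ).toFun (HeapOf.of α)) (((HeapOf.of ρ.snd) • φ).toFun (HeapOf.of α)) = _
  rw [h, coinduced_zeroAct, coinduced_smul, ← φ.map_zmulAt, zmulAt_heapOf, ← φ.map_br]
  refine congrArg φ.toFun (LinearMap.ext fun p => ?_)
  change ρ.fst • α p - 0 + α p * UHull.inr ρ.snd = α p * ρ
  conv_rhs => rw [← UHull.zsmul_one_add_inr ρ, mul_add, mul_smul_comm, mul_one]
  rw [sub_zero]

end Coinduced

/-! The adjunction for modules with a finite dual basis -/

section Adjunction

variable {R P M N X : Type u} [NonUnitalRing R] [AddCommGroup P] [SMul R P] [RingModule R P]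
  [Module (UHull R) P] [AbHeap M] [TrussModule (HeapOf R) M]
  [AbHeap N] [TrussModule (HeapOf R) N] [AbHeap X]

/-- The module homomorphism `p ↦ α(p) m`. -/
def rankOne (hP : ∀ (r : R) (p : P), UHull.inr r • p = r • p)
    (α : LeftDual (UHull R) P) (m : M) : ModHom (HeapOf R) (HeapOf P) M where
  toFun p := uact (α p.val) m
  map_br a b c := by
    rw [← uact_br_left, ← map_sub, ← map_add]
    rfl
  map_smul r p := by
    refine Eq.trans ?_ (smul_uact r.val (α p.val) m).symm
    change uact (α (r.val • p.val)) m = _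
    rw [← hP, map_smul, smul_eq_mul]

variable (hP : ∀ (r : R) (p : P), UHull.inr r • p = r • p)

theorem comp_rankOne (f : ModHom (HeapOf R) M N) (α : LeftDual (UHull R) P) (m : M) :
    f.comp (rankOne hP α m) = rankOne hP α (f.toFun m) :=
  ModHom.ext (funext fun _ => f.map_uact _ _)

/-- The transpose of a heap homomorphism out of a heap of module homomorphisms. -/
def transpose (Ψ : HeapHom (ModHom (HeapOf R) (HeapOf P) M) X) :
    ModHom (HeapOf R) M (HeapHom (HeapOf (LeftDual (UHull R) P)) X) where
  toFun m :=
    { toFun := fun α => Ψ.toFun (rankOne hP α.val m)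
      map_br := fun a b c => by
        rw [← Ψ.map_br]
        exact congrArg Ψ.toFun (ModHom.ext (funext fun p => uact_br_left _ _ _ _)) }
  map_br a b c := by
    refine HeapHom.ext (funext fun α => Eq.trans (congrArg Ψ.toFun ?_) (Ψ.map_br _ _ _))
    exact ModHom.ext (funext fun p => uact_br _ _ _ _)
  map_smul r m := by
    refine HeapHom.ext (funext fun α => congrArg Ψ.toFun (ModHom.ext (funext fun p => ?_)))
    change uact (α.val p.val) (r • m) = uact (α.val p.val * UHull.inr r.val) m
    rw [uact_mul, uact_inr]
    rfl

variable {ι : Type} [Fintype ι] (x : ι → P) (ξ : ι → LeftDual (UHull R) P)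

/-- The inverse of the transpose, in terms of a dual basis. -/
def untranspose (F : ModHom (HeapOf R) M (HeapHom (HeapOf (LeftDual (UHull R) P)) X)) :
    HeapHom (ModHom (HeapOf R) (HeapOf P) M) X :=
  let term (p : P) (α : LeftDual (UHull R) P) : HeapHom (ModHom (HeapOf R) (HeapOf P) M) X :=
    (HeapHom.eval (HeapOf.of α)).comp (F.toHeapHom.comp (ModHom.eval (HeapOf.of p)))
  -- The base point has to vary with the argument $h$, so the sum is formed in the heap of heap
  -- homomorphisms and not in $X$.
  sumAt (term 0 0) fun i => term (x i) (ξ i)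

theorem untranspose_apply (F : ModHom (HeapOf R) M (HeapHom (HeapOf (LeftDual (UHull R) P)) X))
    (h : ModHom (HeapOf R) (HeapOf P) M) :
    (untranspose x ξ F).toFun h =
      sumAt ((F.toFun (h.toFun (HeapOf.of 0))).toFun (HeapOf.of 0))
        fun i => (F.toFun (h.toFun (HeapOf.of (x i)))).toFun (HeapOf.of (ξ i)) :=
  (HeapHom.eval (K := X) h).map_sumAt _ _

variable (hx : ∀ p, ∑ i, ξ i p • x i = p)

include hx in
-- Since $\Psi$ commutes with heap sums, the claim reduces to $\sum_i \xi_i(-)\,h(x_i) = h$ in the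
-- retract at $h(0)$: this is $h$ applied to the dual basis expansion.
theorem untranspose_transpose (Ψ : HeapHom (ModHom (HeapOf R) (HeapOf P) M) X) :
    untranspose x ξ (transpose hP Ψ) = Ψ := by
  refine HeapHom.ext (funext fun h => ?_)
  rw [untranspose_apply]
  change sumAt (Ψ.toFun (rankOne hP 0 (h.toFun (HeapOf.of 0))))
    (fun i => Ψ.toFun (rankOne hP (ξ i) (h.toFun (HeapOf.of (x i))))) = _
  rw [← Ψ.map_sumAt]
  refine congrArg Ψ.toFun (ModHom.ext (funext fun p => ?_))
  have e : ∀ (α : LeftDual (UHull R) P) (q : P), (rankOne hP α (h.toFun (HeapOf.of q))).toFun p =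
      h.toFun (HeapOf.of (α p.val • q)) := fun α q => by
    rw [← uact_heapOf hP, h.map_uact]
    rfl
  refine ((ModHom.eval (N := M) p).map_sumAt _ _).trans ?_
  simp only [ModHom.eval, e]
  rw [LinearMap.zero_apply, zero_smul]
  refine (h.toHeapHom.map_sumAt _ _).symm.trans ?_
  rw [sumAt_heapOf, hx]
  rfl

include hx in
-- Linearity of $F$ moves scalars into the dual: $F(\alpha(x_i)m)(\xi_i) =
-- F(m)(\xi_i\,\alpha(x_i))$, and $\sum_i \xi_i\,\alpha(x_i) = \alpha$.
theorem transpose_untranspose (F : ModHom (HeapOf R) M (HeapHom (HeapOf (LeftDual (UHull R) P)) X)) :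
    transpose hP (untranspose x ξ F) = F := by
  refine ModHom.ext (funext fun m => HeapHom.ext (funext fun α => ?_))
  change (untranspose x ξ F).toFun (rankOne hP α.val m) = _
  rw [untranspose_apply]
  have e : ∀ (p : P) (β : LeftDual (UHull R) P),
      (F.toFun ((rankOne hP α.val m).toFun (HeapOf.of p))).toFun (HeapOf.of β) =
        (F.toFun m).toFun (HeapOf.of (LeftDual.mulRight (α.val p) β)) := fun p β => by
    rw [← coinduced_uact, ← F.map_uact]
    rfl
  simp only [e, map_zero]
  rw [← (F.toFun m).map_sumAt, sumAt_heapOf]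
  congr 1
  change _ = α.val
  refine LinearMap.ext fun p => ?_
  conv_rhs => rw [← hx p, map_sum]
  refine (LinearMap.sum_apply _ _ _).trans ?_
  exact Finset.sum_congr rfl fun i _ => (map_smul α.val _ _).symm

include hP hx in
theorem preservesFiniteColimits_homFunctor :
    Limits.PreservesFiniteColimits (homFunctor (HeapOf R) (HeapOf P)) := by
  let G : AhCat.{u} → TModCat (HeapOf R) := fun X => ⟨HeapHom (HeapOf (LeftDual (UHull R) P)) X.carrier⟩
  let e : ∀ (M : TModCat (HeapOf R)) (X : AhCat.{u}),
      ((homFunctor (HeapOf R) (HeapOf P)).obj M ⟶ X) ≃ (M ⟶ G X) := fun M X =>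
    { toFun := fun Ψ => transpose hP Ψ
      invFun := fun F => untranspose x ξ F
      left_inv := fun Ψ => untranspose_transpose hP x ξ hx Ψ
      right_inv := fun F => transpose_untranspose hP x ξ hx F }
  -- Naturality in $M$ suffices: functoriality of the right adjoint in $X$ is induced by the
  -- bijections.
  have adj := Adjunction.adjunctionOfEquivRight (F := homFunctor (HeapOf R) (HeapOf P)) e
    fun M' M X f g => by
      refine ModHom.ext (funext fun m => HeapHom.ext (funext fun α => ?_))
      exact congrArg (HeapHom.toFun g) (comp_rankOne hP f α.val m)
  have := adj.leftAdjoint_preservesColimits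
  infer_instance

end Adjunction

end TrussMod
namespace TrussMod

open AbHeap

/-! Finitely generated and projective modules over a ring -/

section RingModules

/-- Restriction of scalars from the unitization. -/
theorem ringModule_of_hull {R M : Type u} [NonUnitalRing R] [AddCommGroup M] [Module (UHull R) M] :
    letI : SMul R M := ⟨fun r m => UHull.inr r • m⟩
    RingModule R M :=
  letI : SMul R M := ⟨fun r m => UHull.inr r • m⟩
  { smul_smul' := fun r s m => by
      change UHull.inr r • UHull.inr s • m = UHull.inr (r * s) • m
      rw [UHull.inr_mul, mul_smul]
    add_smul' := fun r s m => by
      change UHull.inr (r + s) • m = UHull.inr r • m + UHull.inr s • m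
      rw [UHull.inr_add, add_smul]
    smul_add' := fun r m n => by
      change UHull.inr r • (m + n) = UHull.inr r • m + UHull.inr r • n
      rw [smul_add] }

variable {R P : Type u}

theorem RingModule.IsFG.finite_hull [NonUnitalRing R] [AddCommGroup P] [SMul R P] [RingModule R P]
    (h : RingModule.IsFG R P) : letI := unitizationModule R P; Module.Finite (UHull R) P := by
  letI := unitizationModule R P
  obtain ⟨S, hS, h⟩ := h
  refine ⟨⟨hS.toFinset, ?_⟩⟩
  rw [hS.coe_toFinset, ← Submodule.toAddSubgroup_inj]
  refine h _ Submodule.subset_span fun r x hx => ?_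
  rw [← unitizationModule_inr_smul R P r x]
  exact Submodule.smul_mem _ _ hx

theorem RingModule.IsProjective.projective_hull [NonUnitalRing R] [AddCommGroup P] [SMul R P]
    [RingModule R P] (h : RingModule.IsProjective R P) :
    letI := unitizationModule R P; Module.Projective (UHull R) P := by
  letI := unitizationModule R P
  refine Module.Projective.of_lifting_property fun {M N} _ _ _ _ f g hf => ?_
  letI : SMul R M := ⟨fun r m => UHull.inr r • m⟩
  letI : SMul R N := ⟨fun r m => UHull.inr r • m⟩
  haveI : RingModule R M := ringModule_of_hull
  haveI : RingModule R N := ringModule_of_hull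
  obtain ⟨k, hk, hfk⟩ := h M N f.toAddMonoidHom (fun r m => f.map_smul _ m) g.toAddMonoidHom
    (fun r x => by
      rw [← unitizationModule_inr_smul R P r x]
      exact g.map_smul _ x) hf
  -- An additive $R$-linear map is linear over $\mathbb Z\oplus R$, as it preserves integer
  -- multiples.
  refine ⟨{ k with map_smul' := fun ρ p => ?_ }, LinearMap.ext hfk⟩
  change k (ρ.fst • p + ρ.snd • p) = ρ • k p
  rw [map_add, map_zsmul, hk, UHull.smul_eq ρ (k p)]
  rfl

/-- A finitely generated projective module has a finite dual basis over the unitization. -/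
theorem exists_dual_basis {S P : Type u} [Ring S] [AddCommGroup P] [Module S P]
    [Module.Finite S P] [Module.Projective S P] :
    ∃ (n : ℕ) (x : Fin n → P) (ξ : Fin n → LeftDual S P), ∀ p, ∑ i, ξ i p • x i = p := by
  obtain ⟨n, f, hf⟩ := Module.Finite.exists_fin' S P
  obtain ⟨s, hs⟩ := Module.projective_lifting_property f LinearMap.id hf
  refine ⟨n, fun i => f (Pi.single i 1), fun i => LinearMap.proj i ∘ₗ s, fun p => ?_⟩
  conv_rhs => rw [← LinearMap.id_apply (R := S) p, ← hs, LinearMap.comp_apply,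
    ← Finset.univ_sum_single (s p), map_sum]
  refine Finset.sum_congr rfl fun i _ => ?_
  rw [← map_smul, ← Pi.single_smul, smul_eq_mul, mul_one]
  rfl

/-! ### Comparison with the usual notions for unital modules -/

variable [Ring R] [AddCommGroup P] [Module R P]

theorem RingModule.isFG_iff_finite : RingModule.IsFG R P ↔ Module.Finite R P := by
  constructor
  · rintro ⟨S, hS, h⟩
    refine ⟨⟨hS.toFinset, ?_⟩⟩
    rw [hS.coe_toFinset, ← Submodule.toAddSubgroup_inj]
    exact h _ Submodule.subset_span fun r x hx => Submodule.smul_mem _ _ hx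
  · rintro ⟨S, hS⟩
    refine ⟨S, S.finite_toSet, fun N hN hs => ?_⟩
    let N' : Submodule R P := { N with smul_mem' := fun r x hx => hs r x hx }
    have h : Submodule.span R (S : Set P) ≤ N' := Submodule.span_le.2 hN
    rw [hS] at h
    exact eq_top_iff.2 h

theorem RingModule.isProjective_iff_projective :
    RingModule.IsProjective R P ↔ Module.Projective R P := by
  constructor
  · intro h
    refine Module.Projective.of_lifting_property fun {M N} _ _ _ _ f g hf => ?_
    obtain ⟨k, hk, hfk⟩ := h M N f.toAddMonoidHom f.map_smul g.toAddMonoidHom g.map_smul hf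
    exact ⟨{ k with map_smul' := hk }, LinearMap.ext hfk⟩
  · intro h M N _ _ _ _ _ _ p hp f hf hsurj
    -- The test modules may be non-unital, so the lift is built by hand: embed $P$ in the free
    -- module on its elements by the section $s$, then send $t\cdot[x]$ to $t\cdot m_x$, where $m_x$
    -- lifts $f(x)$. Linearity of this map does not need $1$ to act as the identity on $M$.
    obtain ⟨s, hs⟩ := h.out
    choose m hm using fun x => hsurj (f x)
    let act (x : M) : R →+ M := AddMonoidHom.mk' (fun r => r • x) fun r t =>
      RingModule.add_smul' r t x
    let k : (P →₀ R) →+ M := Finsupp.liftAddHom fun x => act (m x)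
    have hks : ∀ x t, k (Finsupp.single x t) = t • m x := fun x t =>
      Finsupp.liftAddHom_apply_single _ _ _
    have hk : ∀ (r : R) (c : P →₀ R), k (r • c) = r • k c := by
      intro r c
      let φ : M →+ M := AddMonoidHom.mk' (fun x => r • x) (RingModule.smul_add' r)
      have h : k.comp (DistribSMul.toAddMonoidHom (P →₀ R) r) = φ.comp k := by
        ext x t
        change k (r • Finsupp.single x t) = r • k (Finsupp.single x t)
        rw [Finsupp.smul_single, hks, hks, RingModule.smul_smul', smul_eq_mul]
      exact DFunLike.congr_fun h c
    have hpk : ∀ c : P →₀ R, p (k c) = f (Finsupp.linearCombination R id c) := by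
      intro c
      have h : p.comp k = f.comp (Finsupp.linearCombination R (id : P → P)).toAddMonoidHom := by
        ext x t
        change p (k (Finsupp.single x t)) = f (Finsupp.linearCombination R id (Finsupp.single x t))
        rw [hks, hp, hm, Finsupp.linearCombination_single, id, hf]
      exact DFunLike.congr_fun h c
    refine ⟨k.comp s.toAddMonoidHom, fun r x => ?_, fun x => ?_⟩
    · change k (s (r • x)) = r • k (s x)
      rw [map_smul, hk]
    · change p (k (s x)) = f x
      rw [hpk, hs x]

end RingModules

/-! Properties of modules over the truss of a ring and of their absorber quotients -/

section Absorbers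

variable {R P : Type u} [NonUnitalRing R] [AbHeap P] [TrussModule (HeapOf R) P]

/-- The class of an element in the absorber quotient. -/
def absMk (R : Type u) {P : Type u} [NonUnitalRing R] [AbHeap P] [TrussModule (HeapOf R) P]
    (p : P) : Abs R P := Quotient.mk (absSetoid R P) (some p)

theorem absMk_br (a b c : P) :
    absMk R (br a b c) = absMk R a - absMk R b + absMk R c := by
  -- Written as $a + c = [a,b,c] + b$, the identity involves only sums of representatives.
  rw [sub_add_eq_add_sub, eq_sub_iff_add_eq]
  symm
  refine abs_sound R P (absAdd R P (some a) (some c)) (absAdd R P (some (br a b c)) (some b))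
    fun e => ?_
  letI := retract (zeroAct R P e)
  have h := sub_mem (absVal_add R P e (some a) (some c))
    (absVal_add R P e (some (br a b c)) (some b))
  convert h using 1
  simp only [absVal]
  rw [retract_br (zeroAct R P e) a b c]
  abel

theorem absMk_smul (r : R) (p : P) : absMk R (HeapOf.of r • p) = r • absMk R p := rfl

/-- The projection to the absorber quotient. -/
def absProj (R P : Type u) [NonUnitalRing R] [AbHeap P] [TrussModule (HeapOf R) P] :
    ModHom (HeapOf R) P (HeapOf (Abs R P)) :=
  ⟨fun p => HeapOf.of (absMk R p), absMk_br, fun r p => absMk_smul r.val p⟩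

theorem IsFG.abs (h : IsFG (HeapOf R) P) : RingModule.IsFG R (Abs R P) := by
  obtain ⟨S, hS, h⟩ := h
  refine ⟨absMk R '' S, hS.image _, fun N hN hs => ?_⟩
  have hu := h (absMk R ⁻¹' N) (Set.image_subset_iff.1 hN)
    (fun a ha b hb c hc => by
      change absMk R (br a b c) ∈ N
      rw [absMk_br]
      exact add_mem (sub_mem ha hb) hc)
    (fun t a ha => hs t.val _ ha)
  refine eq_top_iff.2 ?_
  -- The extra representative `none` is $0$, so an empty $P$ needs no separate treatment.
  rintro ⟨_ | a⟩ -
  · exact N.zero_mem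
  · exact (Set.eq_univ_iff_forall.1 hu a :)

/-! ### Factorization through the absorber quotient, and transfer between $M$ and $\mathrm T(M)$ -/

variable {M : Type u} [AddCommGroup M] [SMul R M] [RingModule R M]

theorem ModHom.map_absorber (g : ModHom (HeapOf R) P (HeapOf M)) {a : P}
    (ha : a ∈ absorbers (HeapOf R) P) : (g.toFun a).val = 0 := by
  have h := g.map_smul (HeapOf.of 0) a
  rw [ha] at h
  exact (congrArg HeapOf.val h).trans (RingModule.zero_smul' R M _)

/-- A homomorphism to the module of a ring module factors through the absorber quotient. -/
def absLift (g : ModHom (HeapOf R) P (HeapOf M)) : Abs R P →+ M :=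
  let φ : Option P → M := fun x => x.elim 0 fun a => (g.toFun a).val
  have hbr : ∀ a b c, (g.toFun (br a b c)).val =
      (g.toFun a).val - (g.toFun b).val + (g.toFun c).val := fun a b c =>
    congrArg HeapOf.val (g.map_br a b c)
  AddMonoidHom.mk' (Quotient.lift φ fun x y (h : absRel R P x y) => by
    rcases x with _ | a <;> rcases y with _ | b
    · rfl
    · exact (g.map_absorber h).symm
    · exact g.map_absorber h
    · obtain ⟨s, hs, h⟩ := h
      have e := g.map_absorber h
      rw [hbr, g.map_absorber hs, add_zero] at e
      exact sub_eq_zero.1 e) (by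
    rintro ⟨_ | a⟩ ⟨_ | b⟩
    · exact (add_zero (0 : M)).symm
    · exact (zero_add _).symm
    · exact (add_zero _).symm
    · refine (hbr a _ b).trans ?_
      rw [g.map_absorber (zeroAct_mem R P a), sub_zero]
      rfl)

theorem absLift_smul (g : ModHom (HeapOf R) P (HeapOf M)) (r : R) (x : Abs R P) :
    absLift g (r • x) = r • absLift g x := by
  obtain ⟨_ | a⟩ := x
  · have h := RingModule.smul_add' r (0 : M) 0
    rw [add_zero] at h
    exact (left_eq_add.mp h).symm
  · exact congrArg HeapOf.val (g.map_smul (HeapOf.of r) a)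

/-- A linear map of ring modules as a homomorphism of modules over the truss. -/
def ModHom.ofLinear {N : Type u} [AddCommGroup N] [SMul R N] [RingModule R N] (f : M →+ N)
    (hf : ∀ (r : R) (m : M), f (r • m) = r • f m) : ModHom (HeapOf R) (HeapOf M) (HeapOf N) where
  toFun m := HeapOf.of (f m.val)
  map_br := (HeapHom.ofAdd f).map_br
  map_smul r m := hf r.val m.val

theorem IsProjective.abs (h : IsProjective (HeapOf R) P) :
    RingModule.IsProjective R (Abs R P) := by
  intro M N _ _ _ _ _ _ p hp f hf hsurj
  obtain ⟨g, hg⟩ := h (HeapOf M) (HeapOf N) (ModHom.ofLinear p hp)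
    ((ModHom.ofLinear f hf).comp (absProj R P)) hsurj
  refine ⟨absLift g, absLift_smul g, ?_⟩
  rintro ⟨_ | a⟩
  · exact (map_zero p).trans (map_zero f).symm
  · exact hg a

theorem RingModule.IsFG.heapOf (h : RingModule.IsFG R M) : TrussMod.IsFG (HeapOf R) (HeapOf M) := by
  obtain ⟨S, hS, h⟩ := h
  -- Adjoining $0$ makes every submodule containing the set a subgroup. It also excludes the empty
  -- submodule, as is needed when $M = 0$ is generated by the empty set.
  refine ⟨insert (HeapOf.of 0) (HeapOf.val ⁻¹' S), Set.Finite.insert _ hS, fun N hN hb hs => ?_⟩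
  have h0 : HeapOf.of (0 : M) ∈ N := hN (Set.mem_insert _ _)
  let N' : AddSubgroup M :=
    { carrier := {m | HeapOf.of m ∈ N}
      zero_mem' := h0
      add_mem' := fun {a b} ha hb' => by
        have e : HeapOf.of (a + b) = br (HeapOf.of a) (HeapOf.of 0) (HeapOf.of b) := by
          change a + b = a - 0 + b
          rw [sub_zero]
        exact (e ▸ hb _ ha _ h0 _ hb' : HeapOf.of (a + b) ∈ N)
      neg_mem' := fun {a} ha => by
        have e : HeapOf.of (-a) = br (HeapOf.of 0) (HeapOf.of a) (HeapOf.of 0) := by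
          change -a = 0 - a + 0
          rw [zero_sub, add_zero]
        exact (e ▸ hb _ h0 _ ha _ h0 : HeapOf.of (-a) ∈ N) }
  have e := h N' (fun x hx => hN (Set.mem_insert_of_mem _ hx)) fun r x hx => hs (HeapOf.of r) _ hx
  exact Set.eq_univ_of_forall fun x => (e ▸ AddSubgroup.mem_top x.val : x.val ∈ N')

theorem IsFG.of_heapOf (h : IsFG (HeapOf R) (HeapOf M)) : RingModule.IsFG R M := by
  obtain ⟨S, hS, h⟩ := h
  refine ⟨HeapOf.of ⁻¹' S, hS, fun N hN hs => ?_⟩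
  have e := h (HeapOf.val ⁻¹' N) hN (fun a ha b hb c hc =>
      (N.add_mem (N.sub_mem ha hb) hc : a.val - b.val + c.val ∈ N))
    fun t a ha => hs t.val _ ha
  exact eq_top_iff.2 fun x _ => (Set.eq_univ_iff_forall.1 e (HeapOf.of x) :)

theorem IsProjective.of_heapOf (h : IsProjective (HeapOf R) (HeapOf M)) :
    RingModule.IsProjective R M := by
  intro A B _ _ _ _ _ _ p hp f hf hsurj
  obtain ⟨g, hg⟩ := h (HeapOf A) (HeapOf B) (ModHom.ofLinear p hp) (ModHom.ofLinear f hf) hsurj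
  -- A heap map between groups is additive once it fixes $0$, and here $0$ is an absorber.
  have h0 : (g.toFun (HeapOf.of 0)).val = 0 :=
    g.map_absorber fun t => by
      have h := RingModule.smul_add' t.val (0 : M) 0
      rw [add_zero] at h
      exact (left_eq_add.mp h :)
  refine ⟨AddMonoidHom.mk' (fun m => (g.toFun (HeapOf.of m)).val) fun a b => ?_,
    fun r x => congrArg HeapOf.val (g.map_smul (HeapOf.of r) (HeapOf.of x)),
    fun x => hg (HeapOf.of x)⟩
  have e : HeapOf.of (a + b) = br (HeapOf.of a) (HeapOf.of 0) (HeapOf.of b) := by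
    change a + b = a - 0 + b
    rw [sub_zero]
  rw [e, g.map_br]
  change (g.toFun (HeapOf.of a)).val - (g.toFun (HeapOf.of 0)).val + (g.toFun (HeapOf.of b)).val = _
  rw [h0, sub_zero]

end Absorbers

/-! Surjections as coequalizers and tiny modules -/

section Tiny

/-- Coequalizers of abelian heaps are surjective. -/
theorem AhCat.surjective_of_isColimit {A B C : AhCat.{u}} {f g : A ⟶ B} {q : B ⟶ C}
    (w : f ≫ q = g ≫ q) (h : Limits.IsColimit (Limits.Cofork.ofπ q w)) :
    Function.Surjective (HeapHom.toFun q) := by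
  -- The image of $q$ is a sub-heap through which the cofork factors. By uniqueness, the induced map
  -- from $C$ followed by the inclusion is the identity, so the image is all of $C$.
  letI : AbHeap (Set.range (HeapHom.toFun q)) :=
    { br := fun a b c => ⟨br a.1 b.1 c.1, by
        obtain ⟨_, x, rfl⟩ := a
        obtain ⟨_, y, rfl⟩ := b
        obtain ⟨_, z, rfl⟩ := c
        exact ⟨br x y z, HeapHom.map_br q x y z⟩⟩
      br_assoc := fun _ _ _ _ _ => Subtype.ext (br_assoc _ _ _ _ _)
      br_right := fun _ _ => Subtype.ext (br_right _ _)
      br_left := fun _ _ => Subtype.ext (br_left _ _)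
      br_comm := fun _ _ _ => Subtype.ext (br_comm _ _ _) }
  let I : AhCat.{u} := ⟨Set.range (HeapHom.toFun q)⟩
  let q' : B ⟶ I := (⟨fun b => ⟨HeapHom.toFun q b, b, rfl⟩, fun a b c =>
    Subtype.ext (HeapHom.map_br q a b c)⟩ : HeapHom B.carrier (Set.range (HeapHom.toFun q)))
  let i : I ⟶ C := (⟨Subtype.val, fun _ _ _ => rfl⟩ :
    HeapHom (Set.range (HeapHom.toFun q)) C.carrier)
  have w' : f ≫ q' = g ≫ q' :=
    HeapHom.ext (funext fun a => Subtype.ext (congrFun (congrArg HeapHom.toFun w) a))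
  let d : C ⟶ I := h.desc (Limits.Cofork.ofπ q' w')
  have hd : q ≫ d = q' := h.fac (Limits.Cofork.ofπ q' w') Limits.WalkingParallelPair.one
  have hid : d ≫ i = 𝟙 C := by
    refine Limits.Cofork.IsColimit.hom_ext h ?_
    change q ≫ d ≫ i = q ≫ 𝟙 C
    rw [← Category.assoc, hd, Category.comp_id]
    rfl
  intro c
  obtain ⟨b, hb⟩ := (HeapHom.toFun d c).2
  exact ⟨b, hb.trans (congrFun (congrArg HeapHom.toFun hid) c)⟩

variable {T M N : Type u} [Truss T] [AbHeap M] [TrussModule T M] [AbHeap N] [TrussModule T N]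

/-- The kernel pair of a module homomorphism. -/
def KernelPair (p : ModHom T M N) : Type u := {x : M × M // p.toFun x.1 = p.toFun x.2}

instance (p : ModHom T M N) : AbHeap (KernelPair p) where
  br a b c := ⟨(br a.1.1 b.1.1 c.1.1, br a.1.2 b.1.2 c.1.2), by
    rw [p.map_br, p.map_br, a.2, b.2, c.2]⟩
  br_assoc _ _ _ _ _ := Subtype.ext (Prod.ext (br_assoc _ _ _ _ _) (br_assoc _ _ _ _ _))
  br_right _ _ := Subtype.ext (Prod.ext (br_right _ _) (br_right _ _))
  br_left _ _ := Subtype.ext (Prod.ext (br_left _ _) (br_left _ _))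
  br_comm _ _ _ := Subtype.ext (Prod.ext (br_comm _ _ _) (br_comm _ _ _))

instance (p : ModHom T M N) : TrussModule T (KernelPair p) where
  smul t a := ⟨(t • a.1.1, t • a.1.2), by rw [p.map_smul, p.map_smul, a.2]⟩
  smul_smul' _ _ _ :=
    Subtype.ext (Prod.ext (TrussModule.smul_smul' _ _ _) (TrussModule.smul_smul' _ _ _))
  br_smul _ _ _ _ :=
    Subtype.ext (Prod.ext (TrussModule.br_smul _ _ _ _) (TrussModule.br_smul _ _ _ _))
  smul_br _ _ _ _ :=
    Subtype.ext (Prod.ext (TrussModule.smul_br _ _ _ _) (TrussModule.smul_br _ _ _ _))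

/-- The first projection of the kernel pair. -/
def KernelPair.fst (p : ModHom T M N) : ModHom T (KernelPair p) M :=
  ⟨fun a => a.1.1, fun _ _ _ => rfl, fun _ _ => rfl⟩

/-- The second projection of the kernel pair. -/
def KernelPair.snd (p : ModHom T M N) : ModHom T (KernelPair p) M :=
  ⟨fun a => a.1.2, fun _ _ _ => rfl, fun _ _ => rfl⟩

/-- A homomorphism that is constant on the fibres of a surjection descends along it. -/
theorem ModHom.exists_desc {L : Type u} [AbHeap L] [TrussModule T L] (p : ModHom T M N)
    (hp : Function.Surjective p.toFun) (f : ModHom T M L)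
    (hf : ∀ x y, p.toFun x = p.toFun y → f.toFun x = f.toFun y) :
    ∃ g : ModHom T N L, ∀ x, g.toFun (p.toFun x) = f.toFun x := by
  choose s hs using hp
  have key : ∀ x, f.toFun (s (p.toFun x)) = f.toFun x := fun x => hf _ _ (hs _)
  refine ⟨⟨fun n => f.toFun (s n), fun a b c => ?_, fun t a => ?_⟩, key⟩
  · rw [← f.map_br]
    exact hf _ _ (by rw [p.map_br, hs, hs, hs, hs])
  · rw [← f.map_smul]
    exact hf _ _ (by rw [p.map_smul, hs, hs])

theorem IsTiny.isProjective {P : Type u} [AbHeap P] [TrussModule T P] (h : IsTiny T P) :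
    IsProjective T P := by
  intro M N _ _ _ _ p f hp
  have := h.2
  let K' : TModCat T := ⟨KernelPair p⟩
  let M' : TModCat T := ⟨M⟩
  let N' : TModCat T := ⟨N⟩
  let k₁ : K' ⟶ M' := KernelPair.fst p
  let k₂ : K' ⟶ M' := KernelPair.snd p
  let q : M' ⟶ N' := p
  have w : k₁ ≫ q = k₂ ≫ q := ModHom.ext (funext fun a => a.2)
  have hq : Nonempty (Limits.IsColimit (Limits.Cofork.ofπ q w)) := by
    refine ⟨Limits.Cofork.IsColimit.mk' _ fun s => ?_⟩
    have hs : ∀ x y : M, p.toFun x = p.toFun y →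
        (ModHom.toFun s.π x) = ModHom.toFun s.π y := fun x y hxy =>
      congrFun (congrArg ModHom.toFun s.condition) (⟨(x, y), hxy⟩ : KernelPair p)
    have hd := p.exists_desc hp s.π hs
    refine ⟨hd.choose, ModHom.ext (funext hd.choose_spec), fun {m} hm => ?_⟩
    refine ModHom.ext (funext fun n => ?_)
    obtain ⟨x, rfl⟩ := hp n
    exact (congrFun (congrArg ModHom.toFun hm) x).trans (hd.choose_spec x).symm
  obtain ⟨hq⟩ := hq
  -- A coequalizer of heaps with target $\mathrm{Hom}(P,N)$; a preimage of the element $f$ is a lift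
  -- of $f$.
  have hF := Limits.isColimitCoforkMapOfIsColimit (homFunctor T P) w hq
  obtain ⟨g, hg⟩ := AhCat.surjective_of_isColimit _ hF f
  exact ⟨g, fun x => congrFun (congrArg ModHom.toFun hg) x⟩

theorem isTiny_heapOf_iff {R P : Type u} [NonUnitalRing R] [AddCommGroup P] [SMul R P]
    [RingModule R P] :
    (RingModule.IsFG R P ∧ RingModule.IsProjective R P) ↔ IsTiny (HeapOf R) (HeapOf P) := by
  constructor
  · rintro ⟨hf, hp⟩
    letI := unitizationModule R P
    haveI := hf.finite_hull
    haveI := hp.projective_hull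
    obtain ⟨n, x, ξ, hx⟩ := exists_dual_basis (S := UHull R) (P := P)
    exact ⟨hf.heapOf,
      preservesFiniteColimits_homFunctor (unitizationModule_inr_smul R P) x ξ hx⟩
  · intro h
    exact ⟨h.1.of_heapOf, h.isProjective.of_heapOf⟩

end Tiny

end TrussMod

theorem proposition6p11 :
    (∀ (R : Type u) [NonUnitalRing R],
      (∀ (P : Type u) [TrussMod.AbHeap P] [TrussMod.TrussModule (TrussMod.HeapOf R) P],
        (TrussMod.IsProjective (TrussMod.HeapOf R) P →
          TrussMod.RingModule.IsProjective R (TrussMod.Abs R P)) ∧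
        (TrussMod.IsFG (TrussMod.HeapOf R) P →
          TrussMod.RingModule.IsFG R (TrussMod.Abs R P)) ∧
        (TrussMod.IsTiny (TrussMod.HeapOf R) P →
          TrussMod.RingModule.IsFG R (TrussMod.Abs R P) ∧
          TrussMod.RingModule.IsProjective R (TrussMod.Abs R P))) ∧
      (∀ (P : Type u) [AddCommGroup P] [SMul R P] [TrussMod.RingModule R P],
        (TrussMod.RingModule.IsFG R P ∧ TrussMod.RingModule.IsProjective R P) ↔
          TrussMod.IsTiny (TrussMod.HeapOf R) (TrussMod.HeapOf P))) ∧
    (∀ (R : Type u) [Ring R],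
      (∀ (P : Type u) [TrussMod.AbHeap P] [TrussMod.TrussModule (TrussMod.HeapOf R) P]
          [TrussMod.IsUnital R P],
        (TrussMod.IsProjective (TrussMod.HeapOf R) P → Module.Projective R (TrussMod.Abs R P)) ∧
        (TrussMod.IsFG (TrussMod.HeapOf R) P → Module.Finite R (TrussMod.Abs R P)) ∧
        (TrussMod.IsTiny (TrussMod.HeapOf R) P →
          Module.Finite R (TrussMod.Abs R P) ∧ Module.Projective R (TrussMod.Abs R P))) ∧
      (∀ (P : Type u) [AddCommGroup P] [Module R P],
        (Module.Finite R P ∧ Module.Projective R P) ↔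
          TrussMod.IsTiny (TrussMod.HeapOf R) (TrussMod.HeapOf P))) := by
  refine ⟨fun R _ => ⟨fun P _ _ => ⟨fun h => h.abs, fun h => h.abs,
    fun h => ⟨h.1.abs, h.isProjective.abs⟩⟩, fun P _ _ _ => TrussMod.isTiny_heapOf_iff⟩,
    fun R _ => ⟨fun P _ _ _ => ?_, fun P _ _ => ?_⟩⟩
  · have hf : TrussMod.IsFG (TrussMod.HeapOf R) P → Module.Finite R (TrussMod.Abs R P) :=
      fun h => TrussMod.RingModule.isFG_iff_finite.1 h.abs
    have hp : TrussMod.IsProjective (TrussMod.HeapOf R) P →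
        Module.Projective R (TrussMod.Abs R P) :=
      fun h => TrussMod.RingModule.isProjective_iff_projective.1 h.abs
    exact ⟨hp, hf, fun h => ⟨hf h.1, hp h.isProjective⟩⟩
  · rw [← TrussMod.isTiny_heapOf_iff, TrussMod.RingModule.isFG_iff_finite,
      TrussMod.RingModule.isProjective_iff_projective]
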